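/- Let $P_6$ be the path on $6$ vertices, $C_4$ the cycle on $4$ vertices, and let the hammer be the graph on $5$ vertices obtained by identifying an endvertex of a path on $3$ vertices with a vertex of a triangle. Let $G$ be a finite simple graph such that none of $P_6$, $C_4$ and the hammer is isomorphic to an induced subgraph of $G$. Then $G$ is $(\omega(G)+1)$-colorable, where $\omega(G)$ is the maximum size of a clique of $G$; that is, the vertices of $G$ can be colored with $\omega(G)+1$ colors so that adjacent vertices get different colors. -/

import Mathlib

/-- The hammer: the triangle `0, 1, 2` with an endvertex of the path `2, 3, 4` on three vertices
identified with the vertex `2` of the triangle. -/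
def hammerGraph : SimpleGraph (Fin 5) :=
  SimpleGraph.fromEdgeSet {s(0, 1), s(0, 2), s(1, 2), s(2, 3), s(3, 4)}

/-- `G` is `H`-free: no induced subgraph of `G` is isomorphic to `H`. -/
def InducedFree {W V : Type*} (H : SimpleGraph W) (G : SimpleGraph V) : Prop :=
  ¬ H.IsIndContained G

namespace SimpleGraph

variable {V : Type*} {G : SimpleGraph V}

/-! Strong induction on a vertex set `s`, always with `G.cliqueNum + 1` colors, driven by clique
cutsets (`ColorOn.of_clique_cutset`). Suppose a 5-hole passes through a vertex of `s`. Any vertex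
off the hole is complete to it, has exactly one neighbor on it, or has none. The complete vertices
form a clique, since `C₄` is excluded. If some vertex of `s` has no neighbor on the hole, that
clique is a cutset. Otherwise it has at most ω - 2 vertices in `s`, and three more colors suffice
for the rest (`Hole5.colorOn`). Without 5-holes, a 6-hole is treated in the same way with two extra
colors (`Hole6.colorOn`). Without either, longer holes contain `P₆`, so Dirac's argument for chordal
graphs applies: `s` is a clique or has a clique cutset (`Excluded.colorOn_of_no_hole`). -/

/-- The vertices of `s` can be properly colored with `n` colors. -/
def ColorOn (G : SimpleGraph V) (s : Finset V) (n : ℕ) : Prop :=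
  ∃ c : V → Fin n, ∀ x ∈ s, ∀ y ∈ s, G.Adj x y → c x ≠ c y

/-- `a, b, c, d, e` is an induced five-cycle. -/
structure Hole5 (G : SimpleGraph V) (a b c d e : V) : Prop where
  ab : G.Adj a b
  bc : G.Adj b c
  cd : G.Adj c d
  de : G.Adj d e
  ea : G.Adj e a
  ac : ¬ G.Adj a c
  bd : ¬ G.Adj b d
  ce : ¬ G.Adj c e
  da : ¬ G.Adj d a
  eb : ¬ G.Adj e b

/-- `a, b, c, d, e, f` is an induced six-cycle. -/
structure Hole6 (G : SimpleGraph V) (a b c d e f : V) : Prop where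
  ab : G.Adj a b
  bc : G.Adj b c
  cd : G.Adj c d
  de : G.Adj d e
  ef : G.Adj e f
  fa : G.Adj f a
  ac : ¬ G.Adj a c
  bd : ¬ G.Adj b d
  ce : ¬ G.Adj c e
  df : ¬ G.Adj d f
  ea : ¬ G.Adj e a
  fb : ¬ G.Adj f b
  ad : ¬ G.Adj a d
  be : ¬ G.Adj b e
  cf : ¬ G.Adj c f

/-- The three forbidden induced subgraphs, spelled out on vertices. -/
structure Excluded (G : SimpleGraph V) : Prop where
  c4 : ∀ {a b c d}, a ≠ c → b ≠ d → G.Adj a b → G.Adj b c → G.Adj c d → G.Adj d a →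
    ¬ G.Adj a c → ¬ G.Adj b d → False
  hammer : ∀ {a b c d e}, G.Adj a b → G.Adj a c → G.Adj b c → G.Adj c d → G.Adj d e →
    ¬ G.Adj a d → ¬ G.Adj a e → ¬ G.Adj b d → ¬ G.Adj b e → ¬ G.Adj c e → False
  p6 : ∀ {a b c d e f}, G.Adj a b → G.Adj b c → G.Adj c d → G.Adj d e → G.Adj e f →
    ¬ G.Adj a c → ¬ G.Adj a d → ¬ G.Adj a e → ¬ G.Adj a f → ¬ G.Adj b d → ¬ G.Adj b e →
    ¬ G.Adj b f → ¬ G.Adj c e → ¬ G.Adj c f → ¬ G.Adj d f → False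

/-! ### Forbidden induced subgraphs as adjacency patterns. -/

theorem not_inducedFree_of_adj_iff {n : ℕ} {H : SimpleGraph (Fin n)} (f : Fin n → V)
    (hinj : ∀ i j, i < j → f i ≠ f j) (hadj : ∀ i j, i < j → (G.Adj (f i) (f j) ↔ H.Adj i j)) :
    ¬ InducedFree H G := by
  intro h
  refine h ⟨⟨⟨f, fun i j hij => ?_⟩, fun {i j} => ?_⟩⟩
  · rcases lt_trichotomy i j with hlt | heq | hlt
    · exact absurd hij (hinj i j hlt)
    · exact heq
    · exact absurd hij.symm (hinj j i hlt)
  · change G.Adj (f i) (f j) ↔ H.Adj i j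
    rcases lt_trichotomy i j with hlt | heq | hlt
    · exact hadj i j hlt
    · simp [heq]
    · rw [G.adj_comm, H.adj_comm]
      exact hadj j i hlt

theorem Excluded.of_inducedFree (hP6 : InducedFree (pathGraph 6) G)
    (hC4 : InducedFree (cycleGraph 4) G) (hHammer : InducedFree hammerGraph G) :
    G.Excluded where
  c4 {a b c d} hac hbd h1 h2 h3 h4 h5 h6 := by
    refine not_inducedFree_of_adj_iff ![a, b, c, d] ?_ ?_ hC4
    · have := h1.ne; have := h2.ne; have := h3.ne; have := h4.ne.symm
      simp [Fin.forall_fin_succ, *]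
    · have := h4.symm
      have e1 : (cycleGraph 4).Adj 0 1 := by decide
      have e2 : (cycleGraph 4).Adj 1 2 := by decide
      have e3 : (cycleGraph 4).Adj 2 3 := by decide
      have e4 : (cycleGraph 4).Adj 0 3 := by decide
      have e5 : ¬ (cycleGraph 4).Adj 0 2 := by decide
      have e6 : ¬ (cycleGraph 4).Adj 1 3 := by decide
      intro i j hij
      fin_cases i <;> fin_cases j <;> simp_all
  hammer {a b c d e} h1 h2 h3 h4 h5 n1 n2 n3 n4 n5 := by
    refine not_inducedFree_of_adj_iff ![a, b, c, d, e] ?_ ?_ hHammer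
    -- Distinctness is automatic: identifying two vertices contradicts the prescribed adjacencies.
    · intro i j hij he
      fin_cases i <;> fin_cases j <;> simp at hij he <;> subst he <;>
        simp_all [G.adj_comm]
    · intro i j hij
      fin_cases i <;> fin_cases j <;> simp at hij <;> simp [hammerGraph, *]
  p6 {a b c d e f} h1 h2 h3 h4 h5 n1 n2 n3 n4 n5 n6 n7 n8 n9 n10 := by
    refine not_inducedFree_of_adj_iff ![a, b, c, d, e, f] ?_ ?_ hP6
    · intro i j hij he
      fin_cases i <;> fin_cases j <;> simp at hij he <;> subst he <;>
        simp_all [G.adj_comm]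
    · intro i j hij
      fin_cases i <;> fin_cases j <;> simp at hij <;> simp [pathGraph_adj, *]

/-! ### Attachment of a vertex to a hole. -/

theorem Hole5.rotate {a b c d e : V} (h : G.Hole5 a b c d e) : G.Hole5 b c d e a :=
  ⟨h.bc, h.cd, h.de, h.ea, h.ab, h.bd, h.ce, h.da, h.eb, h.ac⟩

theorem Hole6.rotate {a b c d e f : V} (h : G.Hole6 a b c d e f) : G.Hole6 b c d e f a :=
  ⟨h.bc, h.cd, h.de, h.ef, h.fa, h.ab, h.bd, h.ce, h.df, h.ea, h.fb, h.ac, h.be, h.cf,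
    fun k => h.ad k.symm⟩

theorem Excluded.adj_mid (hG : G.Excluded) {a b c x : V} (hab : G.Adj a b) (hbc : G.Adj b c)
    (hac : ¬ G.Adj a c) (hne : a ≠ c) (hx : x ≠ b) (hxa : G.Adj x a) (hxc : G.Adj x c) :
    G.Adj x b := by
  by_contra h
  exact hG.c4 hx hne hxa hab hbc hxc.symm h hac |>.elim

/-- A vertex forming a triangle with the first edge of an induced path on four vertices is adjacent
to the third vertex. -/
theorem Excluded.adj_next (hG : G.Excluded) {a b c d x : V} (hab : G.Adj a b) (hbc : G.Adj b c)
    (hcd : G.Adj c d) (hac : ¬ G.Adj a c) (hbd : ¬ G.Adj b d) (had : ¬ G.Adj a d)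
    (hxa : G.Adj x a) (hxb : G.Adj x b) : G.Adj x c := by
  by_contra h
  by_cases hxd : G.Adj x d
  · refine h (hG.adj_mid hbc hcd hbd ?_ ?_ hxb hxd)
    · rintro rfl; exact had hab
    · rintro rfl; exact hac hxa.symm
  · exact hG.hammer hxa hxb hab hbc hcd h hxd hac had hbd

/-- Two consecutive neighbors propagate around the hole by repeated use of `Excluded.adj_next`. -/
theorem Hole5.all_adj (hG : G.Excluded) {a b c d e x : V} (h : G.Hole5 a b c d e)
    (hxa : G.Adj x a) (hxb : G.Adj x b) :
    G.Adj x a ∧ G.Adj x b ∧ G.Adj x c ∧ G.Adj x d ∧ G.Adj x e := by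
  have hc := hG.adj_next h.ab h.bc h.cd h.ac h.bd (fun k => h.da k.symm) hxa hxb
  have hd := hG.adj_next h.bc h.cd h.de h.bd h.ce (fun k => h.eb k.symm) hxb hc
  exact ⟨hxa, hxb, hc, hd,
    hG.adj_next h.cd h.de h.ea h.ce h.da (fun k => h.ac k.symm) hc hd⟩

theorem Hole6.all_adj (hG : G.Excluded) {a b c d e f x : V} (h : G.Hole6 a b c d e f)
    (hxa : G.Adj x a) (hxb : G.Adj x b) :
    G.Adj x a ∧ G.Adj x b ∧ G.Adj x c ∧ G.Adj x d ∧ G.Adj x e ∧ G.Adj x f := by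
  have hc := hG.adj_next h.ab h.bc h.cd h.ac h.bd h.ad hxa hxb
  have hd := hG.adj_next h.bc h.cd h.de h.bd h.ce h.be hxb hc
  have he := hG.adj_next h.cd h.de h.ef h.ce h.df h.cf hc hd
  exact ⟨hxa, hxb, hc, hd, he,
    hG.adj_next h.de h.ef h.fa h.df h.ea (fun k => h.ad k.symm) hd he⟩

/-- `x` is adjacent to `a` and to none of `b, c, d, e`. -/
def OnlyAdj (G : SimpleGraph V) (x a b c d e : V) : Prop :=
  G.Adj x a ∧ ¬ G.Adj x b ∧ ¬ G.Adj x c ∧ ¬ G.Adj x d ∧ ¬ G.Adj x e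

/-- A second neighbor at distance two forces, by `C₄`, the hole vertex between; two consecutive
neighbors force all five. -/
theorem Hole5.onlyAdj_of_adj (hG : G.Excluded) {a b c d e x : V} (h : G.Hole5 a b c d e)
    (hxb : x ≠ b) (hxe : x ≠ e) (hxa : G.Adj x a) :
    G.OnlyAdj x a b c d e ∨
      (G.Adj x a ∧ G.Adj x b ∧ G.Adj x c ∧ G.Adj x d ∧ G.Adj x e) := by
  have hab : G.Adj x b → _ := fun k => h.all_adj hG hxa k
  have hea : G.Adj x e → _ := fun k => h.rotate.rotate.rotate.rotate.all_adj hG k hxa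
  have hc : G.Adj x c → G.Adj x b := fun k =>
    hG.adj_mid h.ab h.bc h.ac (by rintro rfl; exact h.da h.cd.symm) hxb hxa k
  have hd : G.Adj x d → G.Adj x e := fun k =>
    hG.adj_mid h.de h.ea h.da (by rintro rfl; exact h.ac h.cd.symm) hxe k hxa
  unfold OnlyAdj
  tauto

/-- An edge `xy` would give the hammer with triangle `x, y, a` and tail `a, b, c`. -/
theorem Excluded.onlyAdj_not_adj (hG : G.Excluded) {a b c d e x y : V} (h : G.Hole5 a b c d e)
    (hx : G.OnlyAdj x a b c d e) (hy : G.OnlyAdj y a b c d e) : ¬ G.Adj x y := fun k =>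
  hG.hammer k hx.1 hy.1 h.ab h.bc hx.2.1 hx.2.2.1 hy.2.1 hy.2.2.1 h.ac

theorem Excluded.onlyAdj_not_adj_next (hG : G.Excluded) {a b c d e x y : V}
    (h : G.Hole5 a b c d e) (hx : G.OnlyAdj x a b c d e) (hy : G.OnlyAdj y b c d e a) :
    ¬ G.Adj x y := fun k =>
  hG.c4 (a := x) (b := a) (c := b) (d := y) (by rintro rfl; exact hx.2.2.1 h.bc)
    (by rintro rfl; exact hy.2.2.2.1 h.ea.symm) hx.1 h.ab hy.1.symm k.symm hx.2.1
    (fun k' => hy.2.2.2.2 k'.symm)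

/-! ### Coloring tools. -/

theorem ColorOn.of_clique_cutset [DecidableEq V] {s : Finset V} {n : ℕ}
    (ih : ∀ t, t ⊂ s → G.ColorOn t n) (P K : V → Prop)
    (hK : ∀ x ∈ s, ∀ y ∈ s, K x → K y → x ≠ y → G.Adj x y)
    (hPK : ∀ x ∈ s, ∀ y ∈ s, P x → G.Adj x y → P y ∨ K y)
    (hx : ∃ x ∈ s, P x ∧ ¬ K x) (hy : ∃ y ∈ s, ¬ P y ∧ ¬ K y) : G.ColorOn s n := by
  classical
  obtain ⟨x, hxs, hxP, hxK⟩ := hx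
  obtain ⟨y, hys, hyP, hyK⟩ := hy
  obtain ⟨c₁, h₁⟩ := ih (s.filter fun z => P z ∨ K z)
    (Finset.filter_ssubset.2 ⟨y, hys, by tauto⟩)
  obtain ⟨c₂, h₂⟩ := ih (s.filter fun z => ¬ P z ∨ K z)
    (Finset.filter_ssubset.2 ⟨x, hxs, by tauto⟩)
  let S := {z // z ∈ s ∧ K z}
  have i₁ : Function.Injective fun z : S => c₁ z := by
    intro z w hzw
    by_contra hne
    exact h₁ z (by simp [z.2]) w (by simp [w.2])
      (hK _ z.2.1 _ w.2.1 z.2.2 w.2.2 fun k => hne (Subtype.ext k)) hzw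
  have i₂ : Function.Injective fun z : S => c₂ z := by
    intro z w hzw
    by_contra hne
    exact h₂ z (by simp [z.2]) w (by simp [w.2])
      (hK _ z.2.1 _ w.2.1 z.2.2 w.2.2 fun k => hne (Subtype.ext k)) hzw
  -- Both colorings are injective on the clique, so matching them there is a partial bijection of
  -- colors, which extends to a permutation.
  obtain ⟨σ, hσ⟩ : ∃ σ : Equiv.Perm (Fin n), ∀ z : S, σ (c₂ z) = c₁ z := by
    let e := (Equiv.ofInjective _ i₂).symm.trans (Equiv.ofInjective _ i₁)
    refine ⟨e.extendSubtype, fun z => ?_⟩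
    rw [Equiv.extendSubtype_apply_of_mem e _ ⟨z, rfl⟩]
    have : (⟨c₂ z, z, rfl⟩ : Set.range fun z : S => c₂ z) = Equiv.ofInjective _ i₂ z := rfl
    simp only [e, Equiv.trans_apply]
    erw [this, Equiv.symm_apply_apply]
    rfl
  refine ⟨fun z => if P z ∨ K z then c₁ z else σ (c₂ z), fun z hz w hw hzw => ?_⟩
  have hσ' : ∀ z ∈ s, K z → σ (c₂ z) = c₁ z := fun z hz hk => hσ ⟨z, hz, hk⟩
  have key : ∀ z ∈ s, ∀ w ∈ s, G.Adj z w → (P z ∨ K z) → ¬ (P w ∨ K w) → c₁ z ≠ σ (c₂ w) := by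
    intro z hz w hw hzw hz' hw'
    have hPz : ¬ P z := fun k => hw' (hPK z hz w hw k hzw)
    have hKz : K z := by tauto
    rw [← hσ' z hz hKz]
    exact fun k => h₂ z (by simp [*]) w (by simp; tauto) hzw (σ.injective k)
  by_cases hz' : P z ∨ K z <;> by_cases hw' : P w ∨ K w <;> simp only [hz', hw', if_true, if_false]
  · exact h₁ z (by simp [*]) w (by simp [*]) hzw
  · exact key z hz w hw hzw hz' hw'
  · exact (key w hw z hz hzw.symm hw' hz').symm
  · exact fun k => h₂ z (by simp; tauto) w (by simp; tauto) hzw (σ.injective k)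

theorem ColorOn.of_classes {s K : Finset V} {n m : ℕ} (hcard : K.card + m ≤ n)
    (hn : 0 < n) (col : Fin m → V → Prop) (hs : ∀ x ∈ s, x ∈ K ∨ ∃ i, col i x)
    (hcol : ∀ i x y, col i x → col i y → ¬ G.Adj x y) : G.ColorOn s n := by
  classical
  obtain ⟨φ⟩ : Nonempty ((K ⊕ Fin m) ↪ Fin n) :=
    Function.Embedding.nonempty_of_card_le (by simpa using hcard)
  have hch : ∀ x, ∃ q : Option (K ⊕ Fin m), x ∈ s →
      (∃ h : x ∈ K, q = some (Sum.inl ⟨x, h⟩)) ∨ ∃ i, col i x ∧ q = some (Sum.inr i) := by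
    intro x
    by_cases hx : x ∈ s
    · rcases hs x hx with h | ⟨i, hi⟩
      · exact ⟨_, fun _ => Or.inl ⟨h, rfl⟩⟩
      · exact ⟨_, fun _ => Or.inr ⟨i, hi, rfl⟩⟩
    · exact ⟨none, fun k => absurd k hx⟩
  choose q hq using hch
  -- Vertices outside `s` receive the irrelevant color `0`, whence `0 < n`.
  refine ⟨fun x => (q x).elim ⟨0, hn⟩ φ, fun x hx y hy hxy => ?_⟩
  rcases hq x hx with ⟨h, e⟩ | ⟨i, h, e⟩ <;> rcases hq y hy with ⟨h', e'⟩ | ⟨j, h', e'⟩ <;>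
    simp only [e, e', Option.elim_some, ne_eq, φ.apply_eq_iff_eq, Sum.inl.injEq, Sum.inr.injEq,
      Subtype.mk.injEq, reduceCtorEq, not_false_eq_true]
  · exact hxy.ne
  · rintro rfl
    exact hcol _ _ _ h h' hxy

theorem card_add_two_le_cliqueNum [Finite V] {K : Finset V} (hK : G.IsClique K) {a b : V}
    (hab : G.Adj a b) (ha : ∀ x ∈ K, G.Adj x a) (hb : ∀ x ∈ K, G.Adj x b) :
    K.card + 2 ≤ G.cliqueNum := by
  classical
  have h : G.IsClique (insert a (insert b K) : Finset V) := by
    push_cast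
    refine (hK.insert fun x hx _ => (hb x hx).symm).insert fun x hx _ => ?_
    rcases hx with rfl | hx
    · exact hab
    · exact (ha x hx).symm
  have := h.card_le_cliqueNum
  rwa [Finset.card_insert_of_notMem, Finset.card_insert_of_notMem] at this
  · exact fun k => (hb _ k).ne rfl
  · rw [Finset.mem_insert]
    rintro (k | k)
    · exact hab.ne k
    · exact (ha _ k).ne rfl

/-! ### The 5-hole case. -/

theorem Hole5.colorOn [Finite V] (hG : G.Excluded) {s : Finset V}
    (ih : ∀ t, t ⊂ s → G.ColorOn t (G.cliqueNum + 1)) {a b c d e : V} (h : G.Hole5 a b c d e)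
    (ha : a ∈ s) : G.ColorOn s (G.cliqueNum + 1) := by
  classical
  have hba := h.ab.symm
  have hcb := h.bc.symm
  have hdc := h.cd.symm
  have hed := h.de.symm
  have hae := h.ea.symm
  let K : V → Prop := fun x => G.Adj x a ∧ G.Adj x b ∧ G.Adj x c ∧ G.Adj x d ∧ G.Adj x e
  let D : V → Prop := fun x => ¬ G.Adj x a ∧ ¬ G.Adj x b ∧ ¬ G.Adj x c ∧ ¬ G.Adj x d ∧ ¬ G.Adj x e
  have hKK : ∀ x y, K x → K y → x ≠ y → G.Adj x y := by
    intro x y hx hy hxy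
    by_contra hn
    exact hG.c4 (a := x) (b := a) (c := y) (d := c) hxy (by rintro rfl; exact h.da h.cd.symm)
      hx.1 hy.1.symm hy.2.2.1 hx.2.2.1.symm hn h.ac
  let S : V → V → V → V → V → V → Prop := G.OnlyAdj
  have hclass : ∀ x, K x ∨ D x ∨ (x = a ∨ x = b ∨ x = c ∨ x = d ∨ x = e) ∨ S x a b c d e ∨
      S x b c d e a ∨ S x c d e a b ∨ S x d e a b c ∨ S x e a b c d := by
    intro x
    by_cases hx : x = a ∨ x = b ∨ x = c ∨ x = d ∨ x = e
    · exact .inr (.inr (.inl hx))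
    · simp only [not_or] at hx
      obtain ⟨na, nb, nc, nd, ne⟩ := hx
      by_cases ka : G.Adj x a
      · rcases h.onlyAdj_of_adj hG nb ne ka with k | k
        · exact .inr (.inr (.inr (.inl k)))
        · exact .inl k
      by_cases kb : G.Adj x b
      · rcases h.rotate.onlyAdj_of_adj hG nc na kb with k | k
        · exact .inr (.inr (.inr (.inr (.inl k))))
        · exact absurd k.2.2.2.2 ka
      by_cases kc : G.Adj x c
      · rcases h.rotate.rotate.onlyAdj_of_adj hG nd nb kc with k | k
        · exact .inr (.inr (.inr (.inr (.inr (.inl k)))))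
        · exact absurd k.2.2.2.1 ka
      by_cases kd : G.Adj x d
      · rcases h.rotate.rotate.rotate.onlyAdj_of_adj hG ne nc kd with k | k
        · exact .inr (.inr (.inr (.inr (.inr (.inr (.inl k))))))
        · exact absurd k.2.2.1 ka
      by_cases ke : G.Adj x e
      · rcases h.rotate.rotate.rotate.rotate.onlyAdj_of_adj hG na nd ke with k | k
        · exact .inr (.inr (.inr (.inr (.inr (.inr (.inr k))))))
        · exact absurd k.2.1 ka
      exact .inr (.inl ⟨ka, kb, kc, kd, ke⟩)
  by_cases hD : ∃ x ∈ s, D x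
  · refine ColorOn.of_clique_cutset ih D K (fun x _ y _ => hKK x y) ?_ ?_ ⟨a, ha, ?_, ?_⟩
    · intro x _ y _ hx hxy
      -- A vertex seeing only `a` and adjacent to `x` would make `x, y, a, b, c, d` an induced `P₆`.
      have key : ∀ {a b c d e}, G.Hole5 a b c d e → G.OnlyAdj y a b c d e → ¬ G.Adj x a →
          ¬ G.Adj x b → ¬ G.Adj x c → ¬ G.Adj x d → False := fun h hy na nb nc nd =>
        hG.p6 hxy hy.1 h.ab h.bc h.cd na nb nc nd hy.2.1 hy.2.2.1 hy.2.2.2.1 h.ac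
          (fun k => h.da k.symm) h.bd
      obtain ⟨x1, x2, x3, x4, x5⟩ := hx
      rcases hclass y with hy | hy | (rfl | rfl | rfl | rfl | rfl) | hy | hy | hy | hy | hy
      · exact .inr hy
      · exact .inl hy
      · exact absurd hxy x1
      · exact absurd hxy x2
      · exact absurd hxy x3
      · exact absurd hxy x4
      · exact absurd hxy x5
      · exact (key h hy x1 x2 x3 x4).elim
      · exact (key h.rotate hy x2 x3 x4 x5).elim
      · exact (key h.rotate.rotate hy x3 x4 x5 x1).elim
      · exact (key h.rotate.rotate.rotate hy x4 x5 x1 x2).elim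
      · exact (key h.rotate.rotate.rotate.rotate hy x5 x1 x2 x3).elim
    · obtain ⟨x, hx, hxD⟩ := hD
      exact ⟨x, hx, hxD, fun k => hxD.1 k.1⟩
    · exact fun k => k.2.1 h.ab
    · exact fun k => k.1.ne rfl
  · let K' := s.filter K
    have hcard : K'.card + 2 ≤ G.cliqueNum := by
      refine card_add_two_le_cliqueNum ?_ h.ab ?_ ?_
      · intro x hx y hy hxy
        exact hKK x y (Finset.mem_filter.1 hx).2 (Finset.mem_filter.1 hy).2 hxy
      · exact fun x hx => (Finset.mem_filter.1 hx).2.1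
      · exact fun x hx => (Finset.mem_filter.1 hx).2.2.1
    -- Attachment classes of the same or consecutive hole vertices are anticomplete, so each color
    -- takes one or two consecutive classes, together with nonadjacent hole vertices they miss.
    refine ColorOn.of_classes (K := K') (m := 3) (by omega) (by omega)
      ![fun x => x = a ∨ x = c ∨ S x d e a b c ∨ S x e a b c d,
        fun x => x = b ∨ x = d ∨ S x a b c d e,
        fun x => x = e ∨ S x b c d e a ∨ S x c d e a b] ?_ ?_
    · intro x hx
      simp only [K', Finset.mem_filter, hx, true_and, Fin.exists_fin_succ, Matrix.cons_val_zero,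
        Matrix.cons_val_succ, IsEmpty.exists_iff, or_false]
      rcases hclass x with k | k | (k | k | k | k | k) | k | k | k | k | k
      · exact .inl k
      · exact (hD ⟨x, hx, k⟩).elim
      · exact .inr (.inl (.inl k))
      · exact .inr (.inr (.inl (.inl k)))
      · exact .inr (.inl (.inr (.inl k)))
      · exact .inr (.inr (.inl (.inr (.inl k))))
      · exact .inr (.inr (.inr (.inl k)))
      · exact .inr (.inr (.inl (.inr (.inr k))))
      · exact .inr (.inr (.inr (.inr (.inl k))))
      · exact .inr (.inr (.inr (.inr (.inr k))))
      · exact .inr (.inl (.inr (.inr (.inl k))))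
      · exact .inr (.inl (.inr (.inr (.inr k))))
    · have e1 : ∀ x y, S x d e a b c → S y e a b c d → ¬ G.Adj x y := fun x y =>
        hG.onlyAdj_not_adj_next h.rotate.rotate.rotate
      have e2 : ∀ x y, S x b c d e a → S y c d e a b → ¬ G.Adj x y := fun x y =>
        hG.onlyAdj_not_adj_next h.rotate
      have f1 : ∀ x y, S x a b c d e → S y a b c d e → ¬ G.Adj x y := fun x y =>
        hG.onlyAdj_not_adj h
      have f2 : ∀ x y, S x b c d e a → S y b c d e a → ¬ G.Adj x y := fun x y =>
        hG.onlyAdj_not_adj h.rotate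
      have f3 : ∀ x y, S x c d e a b → S y c d e a b → ¬ G.Adj x y := fun x y =>
        hG.onlyAdj_not_adj h.rotate.rotate
      have f4 : ∀ x y, S x d e a b c → S y d e a b c → ¬ G.Adj x y := fun x y =>
        hG.onlyAdj_not_adj h.rotate.rotate.rotate
      have f5 : ∀ x y, S x e a b c d → S y e a b c d → ¬ G.Adj x y := fun x y =>
        hG.onlyAdj_not_adj h.rotate.rotate.rotate.rotate
      have hsymm : ∀ x y, G.Adj x y → G.Adj y x := fun x y k => k.symm
      have hirr : ∀ x, ¬ G.Adj x x := fun x k => k.ne rfl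
      have hS : ∀ x a b c d e, S x a b c d e →
        G.Adj x a ∧ ¬ G.Adj x b ∧ ¬ G.Adj x c ∧ ¬ G.Adj x d ∧ ¬ G.Adj x e := fun _ _ _ _ _ _ k => k
      have := h.ac
      have := h.bd
      clear_value S
      intro i x y
      fin_cases i
      · change (x = a ∨ x = c ∨ S x d e a b c ∨ S x e a b c d) →
          (y = a ∨ y = c ∨ S y d e a b c ∨ S y e a b c d) → _
        clear ih hclass hKK
        grind
      · change (x = b ∨ x = d ∨ S x a b c d e) → (y = b ∨ y = d ∨ S y a b c d e) → _
        clear ih hclass hKK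
        grind
      · change (x = e ∨ S x b c d e a ∨ S x c d e a b) →
          (y = e ∨ S y b c d e a ∨ S y c d e a b) → _
        clear ih hclass hKK
        grind

/-! ### The 6-hole case. -/

theorem Hole6.all_adj_of_adj (hG : G.Excluded)
    {a b c d e f x : V} (h5 : ∀ p q r t, G.Hole5 x p q r t → False) (h : G.Hole6 a b c d e f)
    (hxb : x ≠ b) (hxf : x ≠ f) (hxa : G.Adj x a) :
    G.Adj x a ∧ G.Adj x b ∧ G.Adj x c ∧ G.Adj x d ∧ G.Adj x e ∧ G.Adj x f := by
  by_cases hb : G.Adj x b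
  · exact h.all_adj hG hxa hb
  by_cases hf : G.Adj x f
  · have := h.rotate.rotate.rotate.rotate.rotate.all_adj hG hf hxa
    tauto
  exfalso
  have hc : ¬ G.Adj x c := fun k => hb <|
    hG.adj_mid h.ab h.bc h.ac (by rintro rfl; exact h.ad h.cd) hxb hxa k
  have he : ¬ G.Adj x e := fun k => hf <|
    hG.adj_mid h.ef h.fa h.ea (by rintro rfl; exact h.be h.ab.symm) hxf k hxa
  -- Now `x` sees at most `a` and `d`: seeing both closes a 5-hole through `x`, seeing only `a`
  -- gives a `P₆`.
  by_cases hd : G.Adj x d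
  · exact h5 _ _ _ _ ⟨hxa, h.ab, h.bc, h.cd, hd.symm, hb, h.ac, h.bd, fun k => hc k.symm,
      fun k => h.ad k.symm⟩
  · exact hG.p6 hxa h.ab h.bc h.cd h.de hb hc hd he h.ac h.ad (fun k => h.ea k.symm)
      h.bd h.be h.ce

theorem Hole6.colorOn [Finite V] (hG : G.Excluded) {s : Finset V}
    (ih : ∀ t, t ⊂ s → G.ColorOn t (G.cliqueNum + 1))
    (h5 : ∀ x ∈ s, ∀ p q r t, G.Hole5 x p q r t → False)
    {a b c d e f : V} (h : G.Hole6 a b c d e f)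
    (ha : a ∈ s) : G.ColorOn s (G.cliqueNum + 1) := by
  classical
  have hba := h.ab.symm
  have hcb := h.bc.symm
  have hdc := h.cd.symm
  have hed := h.de.symm
  have hfe := h.ef.symm
  have haf := h.fa.symm
  let K : V → Prop := fun x =>
    G.Adj x a ∧ G.Adj x b ∧ G.Adj x c ∧ G.Adj x d ∧ G.Adj x e ∧ G.Adj x f
  let D : V → Prop := fun x =>
    ¬ G.Adj x a ∧ ¬ G.Adj x b ∧ ¬ G.Adj x c ∧ ¬ G.Adj x d ∧ ¬ G.Adj x e ∧ ¬ G.Adj x f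
  have hKK : ∀ x y, K x → K y → x ≠ y → G.Adj x y := by
    intro x y hx hy hxy
    by_contra hn
    exact hG.c4 (a := x) (b := a) (c := y) (d := c) hxy (by rintro rfl; exact h.ad h.cd)
      hx.1 hy.1.symm hy.2.2.1 hx.2.2.1.symm hn h.ac
  have hclass : ∀ x ∈ s, K x ∨ D x ∨ x = a ∨ x = b ∨ x = c ∨ x = d ∨ x = e ∨ x = f := by
    intro x hx
    by_cases hx' : x = a ∨ x = b ∨ x = c ∨ x = d ∨ x = e ∨ x = f
    · exact .inr (.inr hx')
    · simp only [not_or] at hx'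
      obtain ⟨na, nb, nc, nd, ne, nf⟩ := hx'
      by_cases ka : G.Adj x a
      · exact .inl (h.all_adj_of_adj hG (h5 x hx) nb nf ka)
      by_cases kb : G.Adj x b
      · exact absurd (h.rotate.all_adj_of_adj hG (h5 x hx) nc na kb).2.2.2.2.2 ka
      by_cases kc : G.Adj x c
      · exact absurd (h.rotate.rotate.all_adj_of_adj hG (h5 x hx) nd nb kc).2.2.2.2.1 ka
      by_cases kd : G.Adj x d
      · exact absurd (h.rotate.rotate.rotate.all_adj_of_adj hG (h5 x hx) ne nc kd).2.2.2.1 ka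
      by_cases ke : G.Adj x e
      · exact absurd (h.rotate.rotate.rotate.rotate.all_adj_of_adj hG (h5 x hx) nf nd ke).2.2.1 ka
      by_cases kf : G.Adj x f
      · exact absurd
          (h.rotate.rotate.rotate.rotate.rotate.all_adj_of_adj hG (h5 x hx) na ne kf).2.1 ka
      exact .inr (.inl ⟨ka, kb, kc, kd, ke, kf⟩)
  by_cases hD : ∃ x ∈ s, D x
  · refine ColorOn.of_clique_cutset ih D K (fun x _ y _ => hKK x y) ?_ ?_ ⟨a, ha, ?_, ?_⟩
    · rintro x _ y hy ⟨x1, x2, x3, x4, x5, x6⟩ hxy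
      rcases hclass y hy with hy | hy | rfl | rfl | rfl | rfl | rfl | rfl
      · exact .inr hy
      · exact .inl hy
      · exact absurd hxy x1
      · exact absurd hxy x2
      · exact absurd hxy x3
      · exact absurd hxy x4
      · exact absurd hxy x5
      · exact absurd hxy x6
    · obtain ⟨x, hx, hxD⟩ := hD
      exact ⟨x, hx, hxD, fun k => hxD.1 k.1⟩
    · exact fun k => k.2.1 h.ab
    · exact fun k => k.1.ne rfl
  · let K' := s.filter K
    have hcard : K'.card + 2 ≤ G.cliqueNum := by
      refine card_add_two_le_cliqueNum ?_ h.ab ?_ ?_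
      · intro x hx y hy hxy
        exact hKK x y (Finset.mem_filter.1 hx).2 (Finset.mem_filter.1 hy).2 hxy
      · exact fun x hx => (Finset.mem_filter.1 hx).2.1
      · exact fun x hx => (Finset.mem_filter.1 hx).2.2.1
    refine ColorOn.of_classes (K := K') (m := 2) (by omega) (by omega)
      ![fun x => x = a ∨ x = c ∨ x = e, fun x => x = b ∨ x = d ∨ x = f] ?_ ?_
    · intro x hx
      simp only [K', Finset.mem_filter, hx, true_and, Fin.exists_fin_succ, Matrix.cons_val_zero,
        Matrix.cons_val_succ, IsEmpty.exists_iff, or_false]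
      have := hclass x hx
      have : ¬ D x := fun k => hD ⟨x, hx, k⟩
      tauto
    · have n1 := h.ac
      have n2 := h.ce
      have n3 := h.ea
      have n4 := h.bd
      have n5 := h.df
      have n6 := h.fb
      intro i x y
      fin_cases i
      · change (x = a ∨ x = c ∨ x = e) → (y = a ∨ y = c ∨ y = e) → _
        rintro (rfl | rfl | rfl) (rfl | rfl | rfl) k <;> first | exact k.ne rfl | simp_all [G.adj_comm]
      · change (x = b ∨ x = d ∨ x = f) → (y = b ∨ y = d ∨ y = f) → _
        rintro (rfl | rfl | rfl) (rfl | rfl | rfl) k <;> first | exact k.ne rfl | simp_all [G.adj_comm]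

/-! ### Induced paths through linked sets. -/

/-- Any two vertices of `A` are joined by a path inside `A`. -/
def Linked (G : SimpleGraph V) (A : Finset V) : Prop :=
  ∀ u ∈ A, ∀ v ∈ A, Relation.ReflTransGen (fun p q => G.Adj p q ∧ p ∈ A ∧ q ∈ A) u v

theorem Linked.insert_of_adj [DecidableEq V] {A : Finset V} (hA : G.Linked A) {x w : V} (hw : w ∈ A)
    (hxw : G.Adj x w) : G.Linked (insert x A) := by
  have hmono : ∀ u ∈ A, ∀ v ∈ A, Relation.ReflTransGen
      (fun p q => G.Adj p q ∧ p ∈ insert x A ∧ q ∈ insert x A) u v := fun u hu v hv =>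
    Relation.ReflTransGen.mono (fun p q k => ⟨k.1, Finset.mem_insert_of_mem k.2.1,
      Finset.mem_insert_of_mem k.2.2⟩) u v (hA u hu v hv)
  have hwi : w ∈ insert x A := Finset.mem_insert_of_mem hw
  have hxi : x ∈ insert x A := Finset.mem_insert_self x A
  intro u hu v hv
  rcases Finset.mem_insert.1 hu with rfl | hu' <;> rcases Finset.mem_insert.1 hv with rfl | hv'
  · exact .refl
  · exact .head ⟨hxw, hxi, hwi⟩ (hmono _ hw _ hv')
  · exact .tail (hmono _ hu' _ hw) ⟨hxw.symm, hwi, hxi⟩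
  · exact hmono _ hu' _ hv'

/-- `f` traces a walk of length `n` from `x` to `y` with all inner vertices in `A`. -/
def IsTrace (G : SimpleGraph V) (A : Finset V) (x y : V) (n : ℕ) (f : ℕ → V) : Prop :=
  f 0 = x ∧ f n = y ∧ (∀ i < n, G.Adj (f i) (f (i + 1))) ∧ ∀ i, 0 < i → i < n → f i ∈ A

theorem Linked.exists_isTrace {A : Finset V} (hA : G.Linked A) {x y u v : V} (hu : u ∈ A)
    (hv : v ∈ A) (hxu : G.Adj x u) (hyv : G.Adj y v) : ∃ n f, G.IsTrace A x y n f := by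
  have h := hA u hu v hv
  clear hA
  induction h using Relation.ReflTransGen.head_induction_on generalizing x with
  | refl =>
    refine ⟨2, fun i => if i = 0 then x else if i = 1 then v else y, rfl, rfl, ?_, ?_⟩
    · intro i hi
      interval_cases i
      · exact hxu
      · exact hyv.symm
    · intro i h0 hi
      obtain rfl : i = 1 := by omega
      exact hv
  | @head p q hpq _ ih =>
    obtain ⟨n, f, h0, hn, hadj, hmem⟩ := ih hpq.2.2 hpq.1
    refine ⟨n + 1, fun i => Nat.casesOn i x f, rfl, hn, ?_, ?_⟩
    · rintro (_ | i) hi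
      · change G.Adj x (f 0)
        rwa [h0]
      · exact hadj i (by omega)
    · rintro (_ | _ | i) hpos hi
      · omega
      · change f 0 ∈ A
        rwa [h0]
      · exact hmem (i + 1) (by omega) (by omega)

theorem IsTrace.shortcut {A : Finset V} {x y : V} {n : ℕ} {f : ℕ → V} (h : G.IsTrace A x y n f)
    {i j : ℕ} (hij : i + 1 < j) (hj : j ≤ n) (hadj : G.Adj (f i) (f j)) :
    ∃ m < n, ∃ g, G.IsTrace A x y m g := by
  obtain ⟨h0, hn, ha, hm⟩ := h
  refine ⟨n - (j - i - 1), by omega, fun k => if k ≤ i then f k else f (k + (j - i - 1)), ?_, ?_,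
    ?_, ?_⟩
  · simp [h0]
  · dsimp only
    rw [if_neg (by omega), ← hn]
    congr 1
    omega
  · intro k hk
    dsimp only
    rcases lt_trichotomy k i with hlt | rfl | hlt
    · rw [if_pos hlt.le, if_pos (by omega)]
      exact ha k (by omega)
    · rw [if_pos le_rfl, if_neg (by omega)]
      convert hadj using 2
      omega
    · rw [if_neg (by omega), if_neg (by omega)]
      convert ha (k + (j - i - 1)) (by omega) using 2
      omega
  · intro k h0 hk
    dsimp only
    split_ifs
    · exact hm k h0 (by omega)
    · exact hm _ (by omega) (by omega)

/-- Nonadjacent vertices with neighbors in a linked set are joined through it by an induced path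
on at most five vertices. -/
theorem Linked.exists_short_path (hG : G.Excluded) {A : Finset V} (hA : G.Linked A)
    {x y : V} (hx : ∃ u ∈ A, G.Adj x u) (hy : ∃ v ∈ A, G.Adj y v) (hne : x ≠ y)
    (hxy : ¬ G.Adj x y) :
    (∃ p ∈ A, G.Adj x p ∧ G.Adj p y) ∨
    (∃ p ∈ A, ∃ q ∈ A, G.Adj x p ∧ G.Adj p q ∧ G.Adj q y ∧ ¬ G.Adj x q ∧ ¬ G.Adj p y) ∨
    (∃ p ∈ A, ∃ q ∈ A, ∃ r ∈ A, G.Adj x p ∧ G.Adj p q ∧ G.Adj q r ∧ G.Adj r y ∧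
      ¬ G.Adj x q ∧ ¬ G.Adj x r ∧ ¬ G.Adj p r ∧ ¬ G.Adj p y ∧ ¬ G.Adj q y) := by
  classical
  obtain ⟨u, hu, hxu⟩ := hx
  obtain ⟨v, hv, hyv⟩ := hy
  have hex := hA.exists_isTrace hu hv hxu hyv
  obtain ⟨f, hf⟩ := Nat.find_spec hex
  -- A shortest trace has no chords; at length five or more its first six vertices form a `P₆`.
  have hmin : ∀ i j, i + 1 < j → j ≤ Nat.find hex → ¬ G.Adj (f i) (f j) := by
    intro i j hij hj hadj
    obtain ⟨m, hm, g, hg⟩ := hf.shortcut hij hj hadj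
    exact Nat.find_min hex hm ⟨g, hg⟩
  obtain ⟨n, hn⟩ : ∃ n, n = Nat.find hex := ⟨_, rfl⟩
  rw [← hn] at hf hmin
  obtain ⟨rfl, rfl, ha, hm⟩ := hf
  rcases lt_or_ge n 5 with h5 | h5
  · interval_cases n
    · exact absurd rfl hne
    · exact absurd (ha 0 (by omega)) hxy
    · exact .inl ⟨f 1, hm 1 (by omega) (by omega), ha 0 (by omega), ha 1 (by omega)⟩
    · exact .inr (.inl ⟨f 1, hm 1 (by omega) (by omega), f 2, hm 2 (by omega) (by omega),
        ha 0 (by omega), ha 1 (by omega), ha 2 (by omega), hmin 0 2 (by omega) (by omega),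
        hmin 1 3 (by omega) (by omega)⟩)
    · exact .inr (.inr ⟨f 1, hm 1 (by omega) (by omega), f 2, hm 2 (by omega) (by omega), f 3,
        hm 3 (by omega) (by omega), ha 0 (by omega), ha 1 (by omega), ha 2 (by omega),
        ha 3 (by omega), hmin 0 2 (by omega) (by omega), hmin 0 3 (by omega) (by omega),
        hmin 1 3 (by omega) (by omega), hmin 1 4 (by omega) (by omega),
        hmin 2 4 (by omega) (by omega)⟩)
  · refine (hG.p6 (ha 0 ?_) (ha 1 ?_) (ha 2 ?_) (ha 3 ?_) (ha 4 ?_) (hmin 0 2 ?_ ?_)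
      (hmin 0 3 ?_ ?_) (hmin 0 4 ?_ ?_) (hmin 0 5 ?_ ?_) (hmin 1 3 ?_ ?_) (hmin 1 4 ?_ ?_)
      (hmin 1 5 ?_ ?_) (hmin 2 4 ?_ ?_) (hmin 2 5 ?_ ?_) (hmin 3 5 ?_ ?_)).elim <;> omega

/-- In the absence of holes, the common attachments of two anticomplete linked sets are pairwise
adjacent. -/
theorem Excluded.adj_of_common (hG : G.Excluded) {A B : Finset V} (hA : G.Linked A)
    (hB : G.Linked B) (hAB : ∀ u ∈ A, ∀ v ∈ B, u ≠ v ∧ ¬ G.Adj u v) {x y : V}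
    (h5 : ∀ p q r t, ¬ G.Hole5 x p q r t) (h6 : ∀ p q r t w, ¬ G.Hole6 x p q r t w)
    (hxA : ∃ u ∈ A, G.Adj x u) (hyA : ∃ u ∈ A, G.Adj y u)
    (hxB : ∃ u ∈ B, G.Adj x u) (hyB : ∃ u ∈ B, G.Adj y u) (hne : x ≠ y) : G.Adj x y := by
  by_contra hxy
  have hyx : ¬ G.Adj y x := fun k => hxy k.symm
  have hAB' : ∀ u ∈ A, ∀ v ∈ B, ¬ G.Adj u v := fun u hu v hv => (hAB u hu v hv).2
  have hBA' : ∀ u ∈ A, ∀ v ∈ B, ¬ G.Adj v u := fun u hu v hv k => (hAB u hu v hv).2 k.symm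
  have hs : ∀ {u v}, G.Adj u v → G.Adj v u := fun k => k.symm
  have hs' : ∀ {u v}, ¬ G.Adj u v → ¬ G.Adj v u := fun k k' => k k'.symm
  rcases hA.exists_short_path hG hxA hyA hne hxy with
    ⟨p, hp, a1, a2⟩ | ⟨p, hp, q, hq, a1, a2, a3, n1, n2⟩ |
    ⟨p, hp, q, hq, r, hr, a1, a2, a3, a4, n1, n2, n3, n4, n5⟩ <;>
  rcases hB.exists_short_path hG hxB hyB hne hxy with
    ⟨p', hp', b1, b2⟩ | ⟨p', hp', q', hq', b1, b2, b3, m1, m2⟩ |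
    ⟨p', hp', q', hq', r', hr', b1, b2, b3, b4, m1, m2, m3, m4, m5⟩
  -- The two paths close up to an induced cycle of length 4 to 8: a `C₄`, a 5-hole or a 6-hole
  -- through `x`, or a longer cycle containing `P₆`.
  · exact hG.c4 hne (hAB p hp p' hp').1 a1 a2 (hs b2) (hs b1) hxy (hAB' p hp p' hp')
  · exact h5 p y q' p' ⟨a1, a2, hs b3, hs b2, hs b1, hxy, hAB' _ hp _ hq', hs' m2, hs' m1,
      hBA' _ hp _ hp'⟩
  · exact h6 p y r' q' p' ⟨a1, a2, hs b4, hs b3, hs b2, hs b1, hxy, hAB' _ hp _ hr', hs' m5,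
      hs' m3, hs' m1, hBA' _ hp _ hp', m2, hAB' _ hp _ hq', hs' m4⟩
  · exact h5 p q y p' ⟨a1, a2, a3, hs b2, hs b1, n1, n2, hAB' _ hq _ hp', hyx, hBA' _ hp _ hp'⟩
  · exact h6 p q y q' p' ⟨a1, a2, a3, hs b3, hs b2, hs b1, n1, n2, hAB' _ hq _ hq', hs' m2,
      hs' m1, hBA' _ hp _ hp', hxy, hAB' _ hp _ hq', hAB' _ hq _ hp'⟩
  · exact hG.p6 a3 (hs b4) (hs b3) (hs b2) (hs b1) (hAB' _ hq _ hr') (hAB' _ hq _ hq')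
      (hAB' _ hq _ hp') (hs' n1) (hs' m5) (hs' m4) hyx (hs' m3) (hs' m2) (hs' m1)
  · exact h6 p q r y p' ⟨a1, a2, a3, a4, hs b2, hs b1, n1, n3, n5, hAB' _ hr _ hp', hyx,
      hBA' _ hp _ hp', n2, n4, hAB' _ hq _ hp'⟩
  · exact hG.p6 b3 (hs a4) (hs a3) (hs a2) (hs a1) (hBA' _ hr _ hq') (hBA' _ hq _ hq')
      (hBA' _ hp _ hq') (hs' m1) (hs' n5) (hs' n4) hyx (hs' n3) (hs' n2) (hs' n1)
  · exact hG.p6 a3 a4 (hs b4) (hs b3) (hs b2) n5 (hAB' _ hq _ hr') (hAB' _ hq _ hq')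
      (hAB' _ hq _ hp') (hAB' _ hr _ hr') (hAB' _ hr _ hq') (hAB' _ hr _ hp') (hs' m5) (hs' m4)
      (hs' m3)

/-! ### Clique cutsets in the absence of holes. -/

/-- Disjoint, mutually nonadjacent, linked nonempty subsets of `s`. -/
structure Separated (G : SimpleGraph V) (s A B : Finset V) : Prop where
  subset_left : A ⊆ s
  subset_right : B ⊆ s
  linked_left : G.Linked A
  linked_right : G.Linked B
  nonempty_left : A.Nonempty
  nonempty_right : B.Nonempty
  anti : ∀ u ∈ A, ∀ v ∈ B, u ≠ v ∧ ¬ G.Adj u v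

theorem Separated.insert_left [DecidableEq V] {s A B : Finset V} (h : G.Separated s A B) {x : V}
    (hxs : x ∈ s) (hxB : x ∉ B) (hA : ∃ u ∈ A, G.Adj x u) (hB : ∀ v ∈ B, ¬ G.Adj x v) :
    G.Separated s (insert x A) B where
  subset_left := Finset.insert_subset hxs h.subset_left
  subset_right := h.subset_right
  linked_left := by
    obtain ⟨u, hu, hxu⟩ := hA
    exact h.linked_left.insert_of_adj hu hxu
  linked_right := h.linked_right
  nonempty_left := Finset.insert_nonempty _ _
  nonempty_right := h.nonempty_right
  anti := by
    intro u hu v hv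
    rcases Finset.mem_insert.1 hu with rfl | hu
    · exact ⟨fun k => hxB (k ▸ hv), hB v hv⟩
    · exact h.anti u hu v hv

theorem Excluded.colorOn_of_no_hole (hG : G.Excluded) {s : Finset V} {n : ℕ}
    (ih : ∀ t, t ⊂ s → G.ColorOn t n) (h5 : ∀ x ∈ s, ∀ p q r t, ¬ G.Hole5 x p q r t)
    (h6 : ∀ x ∈ s, ∀ p q r t w, ¬ G.Hole6 x p q r t w) {a b : V} (ha : a ∈ s) (hb : b ∈ s)
    (hne : a ≠ b) (hab : ¬ G.Adj a b) : G.ColorOn s n := by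
  classical
  have hsing : ∀ z : V, G.Linked {z} := by
    intro z u hu v hv
    obtain rfl := Finset.mem_singleton.1 hu
    obtain rfl := Finset.mem_singleton.1 hv
    exact .refl
  have h0 : G.Separated s {a} {b} := ⟨by simpa, by simpa, hsing a, hsing b, by simp, by simp,
    by simpa using ⟨hne, hab⟩⟩
  obtain ⟨⟨A, B⟩, hmem, hmax⟩ := Finset.exists_max_image
    ((s.powerset ×ˢ s.powerset).filter fun q => G.Separated s q.1 q.2) (fun q => q.1.card)
    ⟨({a}, {b}), by simp [h0, ha, hb]⟩
  have hsep : G.Separated s A B := (Finset.mem_filter.1 hmem).2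
  have hmax' : ∀ A', G.Separated s A' B → A'.card ≤ A.card := fun A' hA' =>
    hmax (A', B) (by simp [hA', hA'.subset_left, hA'.subset_right])
  -- By maximality of `A`, a vertex of `s` outside `A` with a neighbor in `A` also has one in `B`.
  -- These common attachments form a clique separating `A` from `B`.
  refine ColorOn.of_clique_cutset ih (· ∈ A)
    (fun x => (∃ u ∈ A, G.Adj x u) ∧ ∃ u ∈ B, G.Adj x u) ?_ ?_ ?_ ?_
  · intro x hx y _ hxK hyK hne
    exact hG.adj_of_common hsep.linked_left hsep.linked_right hsep.anti (h5 x hx) (h6 x hx)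
      hxK.1 hyK.1 hxK.2 hyK.2 hne
  · intro x _ y hy hxA hxy
    by_contra hcon
    rw [not_or] at hcon
    have hyB : ∀ v ∈ B, ¬ G.Adj y v := fun v hv k => hcon.2 ⟨⟨x, hxA, hxy.symm⟩, v, hv, k⟩
    have := hmax' _ (hsep.insert_left hy (fun k => (hsep.anti x hxA y k).2 hxy)
      ⟨x, hxA, hxy.symm⟩ hyB)
    rw [Finset.card_insert_of_notMem hcon.1] at this
    omega
  · obtain ⟨x, hx⟩ := hsep.nonempty_left
    exact ⟨x, hsep.subset_left hx, hx, fun ⟨_, u, hu, k⟩ => (hsep.anti x hx u hu).2 k⟩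
  · obtain ⟨x, hx⟩ := hsep.nonempty_right
    exact ⟨x, hsep.subset_right hx, fun k => (hsep.anti x k x hx).1 rfl,
      fun ⟨⟨u, hu, k⟩, _⟩ => (hsep.anti u hu x hx).2 k.symm⟩

/-! ### The induction. -/

theorem Excluded.colorOn [Finite V] (hG : G.Excluded) (s : Finset V) :
    G.ColorOn s (G.cliqueNum + 1) := by
  induction s using Finset.strongInduction with
  | H s ih =>
    by_cases h5 : ∀ x ∈ s, ∀ p q r t, ¬ G.Hole5 x p q r t
    · by_cases h6 : ∀ x ∈ s, ∀ p q r t w, ¬ G.Hole6 x p q r t w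
      · by_cases hs : G.IsClique s
        · have := hs.card_le_cliqueNum
          exact ColorOn.of_classes (K := s) (m := 0) (by omega) (by omega) (fun i => i.elim0)
            (fun x hx => .inl hx) fun i => i.elim0
        · simp only [isClique_iff, Set.Pairwise, not_forall] at hs
          obtain ⟨a, ha, b, hb, hne, hab⟩ := hs
          exact hG.colorOn_of_no_hole ih h5 h6 ha hb hne hab
      · push Not at h6
        obtain ⟨x, hx, p, q, r, t, w, h⟩ := h6
        exact h.colorOn hG ih h5 hx
    · push Not at h5
      obtain ⟨x, hx, p, q, r, t, h⟩ := h5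
      exact h.colorOn hG ih hx

end SimpleGraph

theorem corollary1p7 {V : Type*} [Finite V] (G : SimpleGraph V)
    (hP6 : InducedFree (SimpleGraph.pathGraph 6) G)
    (hC4 : InducedFree (SimpleGraph.cycleGraph 4) G)
    (hHammer : InducedFree hammerGraph G) :
    G.Colorable (G.cliqueNum + 1) := by
  classical
  have := Fintype.ofFinite V
  obtain ⟨c, hc⟩ := (SimpleGraph.Excluded.of_inducedFree hP6 hC4 hHammer).colorOn Finset.univ
  exact ⟨SimpleGraph.Coloring.mk c fun {x y} h =>
    hc x (Finset.mem_univ x) y (Finset.mem_univ y) h⟩
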